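/- A (one-dimensional) \emph{random geometric graph} $G=(V,E)$ consists of a countable random set $V\subset\mathbb{R}$ of vertices and a random set $E$ of edges, i.e. of unordered pairs of distinct elements of $V$; measurability is understood with respect to the numbers of vertices in Borel subsets of $\mathbb{R}$ and the numbers of edges (viewed as ordered pairs of endpoints) in Borel subsets of $\mathbb{R}^2$. For a vertex $x$ of finite degree $\deg(x)$ and a set $A$ of vertices with $x\notin A$, let $$\mathsf{C}(x\leftrightarrow A)=\deg(x)\cdot \mathbb{P}_x\big(\text{simple random walk on } G \text{ visits } A \text{ before returning to } x\big)$$ be the effective conductance between $x$ and $A$ (unit conductances; it is $0$ if $\deg(x)=0$). The cluster (connected component) $K_x$ of $x$ in $G$ is called \emph{recurrent} if all its vertices have finite degree and $$\lim_{n\to\infty}\mathsf{C}\big(x\leftrightarrow K_x\setminus[-n,n]\big)=0 .$$ In particular, clusters containing a vertex of infinite degree are not recurrent. \textbf{Lemma.} Let $G=(V,E)$ be a random geometric graph on $\mathbb{R}$ whose vertex set is almost surely locally finite, i.e. almost surely $V\cap[-r,r]$ is finite for every $r>0$. Suppose that (a) for some subgroup $H\neq\{0\}$ of $(\mathbb{R},+)$,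 the law of $G$ is invariant under translations by elements of $H$ and ergodic under this action, i.e. every event that is invariant under all translations by elements of $H$ has probability $0$ or $1$; (b) long edges in $G$ eventually disappear at the exponential scale, i.e. $$\sum_{k\in\mathbb{N}}\mathbb{P}\big(\exists\, x\in V\cap[-2^k,2^k],\ y\in V:\ |x-y|\ge 2^k,\ xy\in E\big)<\infty .$$ Then almost surely all clusters of $G$ are recurrent. -/

import Mathlib

open MeasureTheory ProbabilityTheory Filter Set
open scoped ENNReal Topology

/-- A (deterministic) geometric graph on the line: a countable vertex set `verts ⊆ ℝ` together with
a symmetric, irreflexive adjacency relation `Adj` between elements of `verts`, i.e. a subgraph of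
the complete graph on `ℝ` with countably many vertices. -/
structure GeomGraph extends (⊤ : SimpleGraph ℝ).Subgraph where
  countable_verts : verts.Countable

namespace GeomGraph

/-- The σ-algebra on geometric graphs generated by the numbers of vertices in Borel subsets of `ℝ`
and the numbers of edges (as ordered pairs of endpoints) in Borel subsets of `ℝ × ℝ`. -/
noncomputable instance : MeasurableSpace GeomGraph :=
  (⨆ (B : Set ℝ) (_ : MeasurableSet B),
      MeasurableSpace.comap (fun G : GeomGraph => (G.verts ∩ B).encard) ⊤) ⊔
    (⨆ (B : Set (ℝ × ℝ)) (_ : MeasurableSet B),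
      MeasurableSpace.comap (fun G : GeomGraph => ({p : ℝ × ℝ | G.Adj p.1 p.2} ∩ B).encard) ⊤)

/-- The geometric graph `G` shifted by `t`: its vertices are the points `x + t`, `x` a vertex of
`G`, and `x + t`, `y + t` are adjacent iff `x`, `y` are adjacent in `G`. -/
def translate (t : ℝ) (G : GeomGraph) : GeomGraph where
  verts := {x | x - t ∈ G.verts}
  Adj x y := G.Adj (x - t) (y - t)
  adj_sub {x y} h := by
    have h' : x - t ≠ y - t := G.adj_sub h
    simpa using h'
  edge_vert h := G.edge_vert h
  symm := ⟨fun _ _ h => G.symm.symm _ _ h⟩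
  countable_verts := G.countable_verts.preimage (sub_left_injective (b := t))

/-- `G` as a simple graph on its own vertex set. Its connected components are the clusters. -/
abbrev graph (G : GeomGraph) : SimpleGraph G.verts := G.toSubgraph.coe

instance (G : GeomGraph) : Countable G.verts := G.countable_verts.to_subtype

open Classical in
/-- One step of simple random walk (unit conductances): from `x`, jump to a uniformly chosen
neighbour of `x`. By convention the walk stays put at vertices without neighbours or with
infinitely many neighbours, where simple random walk is not defined. -/
noncomputable def step (G : GeomGraph) (x : G.verts) : PMF G.verts :=
  if h : (G.graph.neighborSet x).Finite ∧ (G.graph.neighborSet x).Nonempty then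
    PMF.uniformOfFinset h.1.toFinset (h.1.toFinset_nonempty.2 h.2)
  else PMF.pure x

/-- The transition kernel of simple random walk on `G`. -/
noncomputable def stepKernel (G : GeomGraph) : Kernel G.verts G.verts :=
  Kernel.ofFunOfCountable fun x => (G.step x).toMeasure

instance (G : GeomGraph) : IsMarkovKernel G.stepKernel :=
  ⟨fun x => inferInstanceAs (IsProbabilityMeasure (G.step x).toMeasure)⟩

/-- The same transition kernel, reading off the present state from the path up to time `n`. -/
noncomputable def pathKernel (G : GeomGraph) (n : ℕ) :
    Kernel ((i : Finset.Iic n) → G.verts) G.verts :=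
  G.stepKernel.comap (fun p => p ⟨n, Finset.mem_Iic.2 le_rfl⟩) (measurable_pi_apply _)

instance (G : GeomGraph) (n : ℕ) : IsMarkovKernel (G.pathKernel n) := by
  unfold pathKernel; infer_instance

/-- The law of simple random walk on `G` started at `x`, on the space of paths `ℕ → G.verts`. -/
noncomputable def walk (G : GeomGraph) (x : G.verts) : Measure (ℕ → G.verts) :=
  Kernel.traj (X := fun _ => G.verts) G.pathKernel 0 fun _ => x

/-- The effective conductance between a vertex `x` and a set of vertices `A` not containing `x`:
the degree of `x` times the probability that simple random walk started at `x` visits `A` before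
returning to `x`. -/
noncomputable def effConductance (G : GeomGraph) (x : G.verts) (A : Set G.verts) : ℝ≥0∞ :=
  ((G.graph.neighborSet x).encard : ℝ≥0∞) *
    G.walk x {w | ∃ m ≥ 1, w m ∈ A ∧ ∀ j, 1 ≤ j → j ≤ m → w j ≠ x}

/-- The cluster of `x` is recurrent: all degrees in it are finite, and the effective conductance
between `x` and infinity vanishes, the latter being the limit as `n → ∞` of the effective
conductances between `x` and the part of the cluster of `x` outside `[-n, n]`. -/
def ClusterRecurrent (G : GeomGraph) (x : G.verts) : Prop :=
  (∀ y, G.graph.Reachable x y → (G.graph.neighborSet y).Finite) ∧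
    Tendsto (fun n : ℕ => G.effConductance x
      {y | G.graph.Reachable x y ∧ (y : ℝ) ∉ Icc (-(n : ℝ)) n}) atTop (𝓝 0)

/-- There is a vertex in `[-2^k, 2^k]` with an edge of length at least `2^k`. -/
def HasLongEdge (G : GeomGraph) (k : ℕ) : Prop :=
  ∃ x ∈ G.verts ∩ Icc (-(2 : ℝ) ^ k) (2 ^ k), ∃ y ∈ G.verts, (2 : ℝ) ^ k ≤ |x - y| ∧ G.Adj x y

/-- A law `μ` of a random geometric graph is translation invariant and ergodic under the subgroup
`H` of `(ℝ, +)`: it is preserved by the shifts by elements of `H`, and every event that is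
invariant under all these shifts has probability `0` or `1`. -/
structure InvariantErgodic (H : AddSubgroup ℝ) (μ : Measure GeomGraph) : Prop where
  invariant : ∀ t ∈ H, MeasurePreserving (translate t) μ μ
  ergodic : ∀ S : Set GeomGraph, MeasurableSet S → (∀ t ∈ H, translate t ⁻¹' S = S) →
    μ S = 0 ∨ μ S = 1

end GeomGraph

/-! By Borel–Cantelli, almost surely there are no long edges at any scale `k ≥ k₀`, with `k₀`
random. An edge across the origin then has both endpoints in `[-2^k₀, 2^k₀]`, so local finiteness
makes the origin an `M`-cut for some random `M` (`exists_isCut_zero`). Poincaré recurrence for the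
shifts by `t` and `-t`, with `t ∈ H` positive, turns this one cut into `M`-cuts, with the same `M`,
arbitrarily far out on both sides (`ae_exists_isCut`).

The rest is deterministic, in the spirit of Nash-Williams. Take `K` pairs of cuts around `x`, with
distinct cuts at least `M` apart. Edges across a cut have length at most `M`, so no edge crosses two
of them. A function growing by `1 / K` at each pair therefore has energy of order `M / K`
(`exists_test_function`). By Dirichlet's principle (`SimpleGraph.current_le_energy`) this bounds the
current of the potential in `exists_potential`, which dominates the escape probability times the
degree by `walk_escape_le`. Letting `K → ∞` gives recurrence. -/

namespace GeomGraph

/-! ### Escape probabilities and superharmonic functions -/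

/-- The Markov property of simple random walk at time `n`, in integrated form. -/
theorem lintegral_walk_succ (G : GeomGraph) (x : G.verts) (n : ℕ)
    (g : ((i : Finset.Iic n) → G.verts) → ℝ≥0∞) (h : G.verts → ℝ≥0∞) :
    ∫⁻ w, g (Preorder.frestrictLe n w) * h (w (n + 1)) ∂G.walk x =
      ∫⁻ w, g (Preorder.frestrictLe n w) * ∫⁻ y, h y ∂(G.step (w n)).toMeasure ∂G.walk x := by
  have hg : Measurable g := .of_discrete
  have hh : Measurable h := .of_discrete
  have hstep : Measurable fun y : G.verts => ∫⁻ z, h z ∂(G.step y).toMeasure := .of_discrete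
  have hF : Measurable fun q : ((i : Finset.Iic n) → G.verts) × G.verts => g q.1 * h q.2 := by
    fun_prop
  have key := Kernel.partialTraj_compProd_eq_map_traj (X := fun _ => G.verts)
    (κ := G.pathKernel) (Nat.zero_le n) (x₀ := fun _ => x)
  have h1 := congrArg (fun ν => ∫⁻ q, g q.1 * h q.2 ∂ν) key
  rw [Measure.lintegral_compProd hF, lintegral_map hF (by fun_prop),
    ← Kernel.traj_map_frestrictLe_apply, lintegral_map .of_discrete (by fun_prop)] at h1
  rw [walk, ← h1]
  refine lintegral_congr fun w => ?_
  simp only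
  rw [lintegral_const_mul _ hh]
  rfl

/-- If `h` is superharmonic off `A ∪ {x}` and at least `1` on `A`, then the probability that simple
random walk started at `x` visits `A` before returning to `x` is at most the mean of `h` after one
step. -/
theorem walk_escape_le (G : GeomGraph) (x : G.verts) (A : Set G.verts) (h : G.verts → ℝ≥0∞)
    (hA : ∀ y ∈ A, 1 ≤ h y)
    (hsuper : ∀ y, y ∉ A → y ≠ x → ∫⁻ z, h z ∂(G.step y).toMeasure ≤ h y) :
    G.walk x {w | ∃ m ≥ 1, w m ∈ A ∧ ∀ j, 1 ≤ j → j ≤ m → w j ≠ x} ≤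
      ∫⁻ z, h z ∂(G.step x).toMeasure := by
  classical
  let D : ∀ n : ℕ, Set ((i : Finset.Iic n) → G.verts) :=
    fun n => {p | ∀ i : Finset.Iic n, 1 ≤ (i : ℕ) → p i ∉ A ∧ p i ≠ x}
  -- Time `0` is exempt because the walk starts at `x`. Below, `hit n` is the first visit to `A` at
  -- time `n + 1`, without an earlier return to `x`.
  let alive : ℕ → Set (ℕ → G.verts) := fun n => {w | ∀ j, 1 ≤ j → j ≤ n → w j ∉ A ∧ w j ≠ x}
  have hD (n : ℕ) (w : ℕ → G.verts) : Preorder.frestrictLe n w ∈ D n ↔ w ∈ alive n := by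
    constructor
    · intro hw j hj hjn
      exact hw ⟨j, Finset.mem_Iic.2 hjn⟩ hj
    · intro hw i hi
      exact hw i.1 hi (Finset.mem_Iic.1 i.2)
  have hmeasD (n : ℕ) : MeasurableSet (alive n) := by
    have : alive n = Preorder.frestrictLe n ⁻¹' D n := by
      ext w; exact (hD n w).symm
    rw [this]
    exact (Preorder.measurable_frestrictLe n) (Set.to_countable (D n)).measurableSet
  let hit : ℕ → Set (ℕ → G.verts) := fun n => alive n ∩ {w | w (n + 1) ∈ A}
  have hmeasH (n : ℕ) : MeasurableSet (hit n) :=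
    (hmeasD n).inter ((measurable_pi_apply (n + 1)) (Set.to_countable A).measurableSet)
  let a : ℕ → ℝ≥0∞ := fun n =>
    ∫⁻ w, (alive n).indicator 1 w * ∫⁻ y, h y ∂(G.step (w n)).toMeasure ∂G.walk x
  -- On `alive n`, the value `h (w (n + 1))` pays either `1` for a hit or, by superharmonicity, the
  -- mean needed for the next step. Hence the hitting probabilities telescope.
  have hstep (n : ℕ) : G.walk x (hit n) + a (n + 1) ≤ a n := by
    have e : a n = ∫⁻ w, (alive n).indicator 1 w * h (w (n + 1)) ∂G.walk x := by
      have := G.lintegral_walk_succ x n ((D n).indicator fun _ => 1) h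
      have hi (w : ℕ → G.verts) : (D n).indicator (fun _ => (1 : ℝ≥0∞)) (Preorder.frestrictLe n w) =
          (alive n).indicator 1 w := by
        simp only [Set.indicator_apply, hD, Pi.one_apply]
      simp only [hi] at this
      exact this.symm
    rw [e, ← lintegral_indicator_one (hmeasH n), ← lintegral_add_left
      (measurable_one.indicator (hmeasH n))]
    refine lintegral_mono fun w => ?_
    simp only [Set.indicator_apply, Pi.one_apply]
    by_cases hw : w ∈ alive n
    · by_cases hwA : w (n + 1) ∈ A
      · have h1 : w ∈ hit n := ⟨hw, hwA⟩
        have h2 : w ∉ alive (n + 1) := fun h' => (h' (n + 1) (by omega) le_rfl).1 hwA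
        simp [h1, h2, hw, hA _ hwA]
      · have h1 : w ∉ hit n := fun h' => hwA h'.2
        by_cases h2 : w ∈ alive (n + 1)
        · simp [h1, h2, hw, hsuper _ hwA (h2 (n + 1) (by omega) le_rfl).2]
        · simp [h1, h2]
    · have h1 : w ∉ hit n := fun h' => hw h'.1
      have h2 : w ∉ alive (n + 1) := fun h' => hw fun j hj hjn => h' j hj (by omega)
      simp [h1, h2]
  have hsum (n : ℕ) : ∑ i ∈ Finset.range n, G.walk x (hit i) + a n ≤ a 0 := by
    induction n with
    | zero => simp
    | succ n ih =>
      rw [Finset.sum_range_succ, add_assoc]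
      exact (add_le_add_right (hstep n) _).trans ih
  have hstart : ∀ᵐ w ∂G.walk x, w 0 = x := by
    have e := Kernel.traj_map_frestrictLe_apply (X := fun _ => G.verts)
      (κ := G.pathKernel) 0 0 (fun _ => x)
    rw [Kernel.partialTraj_self, Kernel.id_apply] at e
    have h0 : ∀ᵐ p ∂((G.walk x).map (Preorder.frestrictLe (π := fun _ => G.verts) 0)),
        p ⟨0, Finset.mem_Iic.2 le_rfl⟩ = x := by
      rw [walk, e]
      exact (ae_dirac_iff (Set.to_countable _).measurableSet).2 rfl
    exact ae_of_ae_map (by fun_prop) h0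
  have ha0 : a 0 = ∫⁻ z, h z ∂(G.step x).toMeasure := by
    have hprob : IsProbabilityMeasure (G.walk x) := by unfold walk; infer_instance
    have : a 0 = ∫⁻ _, (∫⁻ z, h z ∂(G.step x).toMeasure) ∂G.walk x := by
      refine lintegral_congr_ae (hstart.mono fun w hw => ?_)
      have : w ∈ alive 0 := fun j hj hj0 => by omega
      simp only [Set.indicator_of_mem this, Pi.one_apply, one_mul]
      rw [hw]
    rw [this, lintegral_const, measure_univ, mul_one]
  have hcover : {w | ∃ m ≥ 1, w m ∈ A ∧ ∀ j, 1 ≤ j → j ≤ m → w j ≠ x} ⊆ ⋃ n, hit n := by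
    rintro w ⟨m, hm, hmA, hmx⟩
    have hex : ∃ m, 1 ≤ m ∧ w m ∈ A := ⟨m, hm, hmA⟩
    have hle : Nat.find hex ≤ m := Nat.find_min' hex ⟨hm, hmA⟩
    obtain ⟨h1, h2⟩ := Nat.find_spec hex
    refine mem_iUnion.2 ⟨Nat.find hex - 1, fun j hj hjn => ⟨fun hjA => ?_, hmx j hj (by omega)⟩, ?_⟩
    · exact Nat.find_min hex (m := j) (by omega) ⟨hj, hjA⟩
    · change w (Nat.find hex - 1 + 1) ∈ A
      rwa [Nat.sub_add_cancel h1]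
  calc _ ≤ G.walk x (⋃ n, hit n) := measure_mono hcover
    _ ≤ ∑' n, G.walk x (hit n) := measure_iUnion_le _
    _ ≤ a 0 := ENNReal.tsum_le_of_sum_range_le fun n => le_self_add.trans (hsum n)
    _ = _ := ha0

end GeomGraph

/-! ### Dirichlet's principle on a finite vertex set -/

/-- The Dirichlet form of `h` and `φ` on a finite vertex set, as a sum over ordered pairs. -/
theorem SimpleGraph.sum_adj_mul_sub {V : Type*} (Γ : SimpleGraph V) [DecidableRel Γ.Adj]
    (W : Finset V) (h φ : V → ℝ) :
    ∑ a ∈ W, ∑ b ∈ W, (if Γ.Adj a b then (h a - h b) * (φ a - φ b) else 0) =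
      2 * ∑ a ∈ W, φ a * ∑ b ∈ W, if Γ.Adj a b then h a - h b else 0 := by
  have h1 : ∑ a ∈ W, ∑ b ∈ W, (if Γ.Adj a b then (h a - h b) * (φ a - φ b) else 0) =
      ∑ a ∈ W, ∑ b ∈ W, φ a * (if Γ.Adj a b then h a - h b else 0) +
        ∑ a ∈ W, ∑ b ∈ W, φ b * (if Γ.Adj b a then h b - h a else 0) := by
    simp only [← Finset.sum_add_distrib]
    refine Finset.sum_congr rfl fun a _ => Finset.sum_congr rfl fun b _ => ?_
    simp only [Γ.adj_comm b a]
    split_ifs <;> ring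
  rw [h1, Finset.sum_comm (s := W) (t := W)
    (f := fun a b => φ b * (if Γ.Adj b a then h b - h a else 0)), ← two_mul]
  simp only [Finset.mul_sum]

/-- Dirichlet's principle: the current out of `x` at the potential `h`, which vanishes at `x`,
equals `1` off `S` and is harmonic on `S \ {x}`, is at most the energy of any `g` with the same
boundary values. -/
theorem SimpleGraph.current_le_energy {V : Type*} (Γ : SimpleGraph V) [DecidableRel Γ.Adj]
    (W S : Finset V) (x : V) (hx : x ∈ W) (h g : V → ℝ)
    (hhx : h x = 0) (hgx : g x = 0)
    (hh1 : ∀ a ∈ W, a ∉ S → h a = 1) (hg1 : ∀ a ∈ W, a ∉ S → g a = 1)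
    (hharm : ∀ a ∈ S, a ≠ x → ∑ b ∈ W, (if Γ.Adj a b then h a - h b else 0) = 0) :
    2 * ∑ b ∈ W, (if Γ.Adj x b then h b else 0) ≤
      ∑ a ∈ W, ∑ b ∈ W, if Γ.Adj a b then (g a - g b) ^ 2 else 0 := by
  -- Orthogonality: `g - h` vanishes wherever `h` fails to be harmonic.
  have e1 : ∑ a ∈ W, ∑ b ∈ W, (if Γ.Adj a b then (h a - h b) * ((g a - h a) - (g b - h b)) else 0)
      = 0 := by
    rw [Γ.sum_adj_mul_sub W h fun a => g a - h a]
    rw [Finset.sum_eq_zero, mul_zero]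
    intro a ha
    by_cases haS : a ∈ S
    · by_cases hax : a = x
      · simp [hax, hhx, hgx]
      · rw [hharm a haS hax, mul_zero]
    · rw [hh1 a ha haS, hg1 a ha haS]; simp
  -- The left side is minus the energy of `h`, since `(1 - h a) - (1 - h b) = -(h a - h b)`. With
  -- `e1` and `e3` this yields Pythagoras in `e4`.
  have e2 : ∑ a ∈ W, ∑ b ∈ W, (if Γ.Adj a b then (h a - h b) * ((1 - h a) - (1 - h b)) else 0)
      = - (2 * ∑ b ∈ W, (if Γ.Adj x b then h b else 0)) := by
    rw [Γ.sum_adj_mul_sub W h fun a => 1 - h a, Finset.sum_eq_single_of_mem x hx]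
    · rw [hhx, sub_zero, one_mul, ← mul_neg, ← Finset.sum_neg_distrib]
      congr 1
      refine Finset.sum_congr rfl fun b _ => ?_
      split_ifs <;> simp
    · intro a ha hax
      by_cases haS : a ∈ S
      · rw [hharm a haS hax, mul_zero]
      · rw [hh1 a ha haS]; simp
  have e3 : (0 : ℝ) ≤ ∑ a ∈ W, ∑ b ∈ W,
      (if Γ.Adj a b then ((g a - h a) - (g b - h b)) ^ 2 else 0) :=
    Finset.sum_nonneg fun a _ => Finset.sum_nonneg fun b _ => by split_ifs <;> positivity
  have e4 : ∑ a ∈ W, ∑ b ∈ W, (if Γ.Adj a b then (g a - g b) ^ 2 else 0) =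
      ∑ a ∈ W, ∑ b ∈ W, (if Γ.Adj a b then ((g a - h a) - (g b - h b)) ^ 2 else 0)
      + 2 * (∑ a ∈ W, ∑ b ∈ W,
        (if Γ.Adj a b then (h a - h b) * ((g a - h a) - (g b - h b)) else 0))
      - ∑ a ∈ W, ∑ b ∈ W,
        (if Γ.Adj a b then (h a - h b) * ((1 - h a) - (1 - h b)) else 0) := by
    simp only [Finset.mul_sum, ← Finset.sum_add_distrib, ← Finset.sum_sub_distrib]
    refine Finset.sum_congr rfl fun a _ => Finset.sum_congr rfl fun b _ => ?_
    split_ifs <;> ring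
  linarith

/-! ### Cuts and their recurrence under translations -/

namespace GeomGraph

/-- There are at most `M` edges across `u`, each of length at most `M`. -/
def IsCut (G : GeomGraph) (M : ℕ) (u : ℝ) : Prop :=
  ({p : ℝ × ℝ | G.Adj p.1 p.2} ∩ Iic u ×ˢ Ioi u).encard ≤ M ∧
    ({p : ℝ × ℝ | G.Adj p.1 p.2} ∩ (Iic u ×ˢ Ioi u ∩ {p | (M : ℝ) < p.2 - p.1})).encard = 0

theorem IsCut.sub_le {G : GeomGraph} {M : ℕ} {u : ℝ} (h : G.IsCut M u) {a b : ℝ}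
    (hab : G.Adj a b) (ha : a ≤ u) (hb : u < b) : b - a ≤ M := by
  by_contra! hlt
  have := Set.encard_eq_zero.1 h.2
  exact Set.eq_empty_iff_forall_notMem.1 this (a, b) ⟨hab, ⟨ha, hb⟩, hlt⟩

/-- The indicator fixes the orientation of the pair, so each edge across `u` is counted only once.
-/
theorem IsCut.sum_le {G : GeomGraph} {M : ℕ} {u : ℝ} (h : G.IsCut M u)
    (W : Finset G.verts) [DecidableRel G.graph.Adj] :
    ∑ a ∈ W, ∑ b ∈ W, (if G.graph.Adj a b then
      (if (a : ℝ) ≤ u ∧ u < b then (1 : ℝ) else 0) else 0) ≤ M := by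
  classical
  rw [← Finset.sum_product']
  simp only [← ite_and]
  rw [Finset.sum_boole]
  norm_cast
  have hinj : Function.Injective fun p : G.verts × G.verts => ((p.1 : ℝ), (p.2 : ℝ)) := by
    rintro ⟨a, b⟩ ⟨c, d⟩ h
    simp only [Prod.mk.injEq] at h
    exact Prod.ext (Subtype.ext h.1) (Subtype.ext h.2)
  have := (Set.encard_le_encard (s := (fun p : G.verts × G.verts => ((p.1 : ℝ), (p.2 : ℝ))) ''
    ↑{p ∈ W ×ˢ W | G.graph.Adj p.1 p.2 ∧ (p.1 : ℝ) ≤ u ∧ u < p.2}) (by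
      rintro _ ⟨p, hp, rfl⟩
      have hp := (Finset.mem_filter.1 (Finset.mem_coe.1 hp)).2
      exact ⟨hp.1, hp.2⟩)).trans h.1
  rw [hinj.encard_image, Set.encard_coe_eq_coe_finsetCard] at this
  exact_mod_cast this

/-- Both conditions, including the length bound, are expressed by edge counts in Borel sets, which
generate the σ-algebra. -/
theorem measurableSet_isCut (M : ℕ) (u : ℝ) : MeasurableSet {G : GeomGraph | G.IsCut M u} := by
  have key (B : Set (ℝ × ℝ)) (hB : MeasurableSet B) (T : Set ℕ∞) :
      MeasurableSet {G : GeomGraph | ({p : ℝ × ℝ | G.Adj p.1 p.2} ∩ B).encard ∈ T} := by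
    refine (le_sup_of_le_right (le_iSup₂_of_le B hB le_rfl) :
      MeasurableSpace.comap (fun G : GeomGraph => ({p : ℝ × ℝ | G.Adj p.1 p.2} ∩ B).encard) ⊤ ≤
        _) _ ?_
    exact ⟨T, trivial, rfl⟩
  have hB : MeasurableSet (Iic u ×ˢ Ioi u : Set (ℝ × ℝ)) := measurableSet_Iic.prod measurableSet_Ioi
  exact (key _ hB (Iic M)).inter
    (key _ (hB.inter (measurableSet_lt measurable_const (by fun_prop))) {0})

theorem isCut_translate (G : GeomGraph) (t : ℝ) (M : ℕ) (u : ℝ) :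
    (translate t G).IsCut M u ↔ G.IsCut M (u - t) := by
  have hinj : Function.Injective fun p : ℝ × ℝ => (p.1 + t, p.2 + t) := by
    rintro ⟨a, b⟩ ⟨c, d⟩ h
    simpa using h
  have key (B B' : Set (ℝ × ℝ)) (hB : ∀ p, p ∈ B ↔ (p.1 - t, p.2 - t) ∈ B') :
      ({p : ℝ × ℝ | (translate t G).Adj p.1 p.2} ∩ B).encard =
        ({p : ℝ × ℝ | G.Adj p.1 p.2} ∩ B').encard := by
    rw [← hinj.encard_image ({p : ℝ × ℝ | G.Adj p.1 p.2} ∩ B')]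
    congr 1
    ext p
    constructor
    · rintro ⟨h1, h2⟩
      exact ⟨(p.1 - t, p.2 - t), ⟨h1, (hB p).1 h2⟩, by simp⟩
    · rintro ⟨q, ⟨h1, h2⟩, rfl⟩
      refine ⟨?_, (hB _).2 (by simpa using h2)⟩
      change G.Adj (q.1 + t - t) (q.2 + t - t)
      simpa using h1
  unfold IsCut
  rw [key _ (Iic (u - t) ×ˢ Ioi (u - t)) (by simp),
    key _ (Iic (u - t) ×ˢ Ioi (u - t) ∩ {p | (M : ℝ) < p.2 - p.1}) (by simp)]

theorem isCut_iterate_translate (G : GeomGraph) (t : ℝ) (M n : ℕ) (u : ℝ) :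
    ((translate t)^[n] G).IsCut M u ↔ G.IsCut M (u - n * t) := by
  induction n generalizing u with
  | zero => simp
  | succ n ih =>
    rw [Function.iterate_succ_apply', isCut_translate, ih]
    push_cast
    rw [show u - t - n * t = u - (n + 1) * t by ring]

/-- Almost surely, if the origin is an `M`-cut, then there are `M`-cuts arbitrarily far out on both
sides. -/
theorem ae_exists_isCut {μ : Measure GeomGraph} [IsFiniteMeasure μ] {H : AddSubgroup ℝ}
    (hH : H ≠ ⊥) (hinv : ∀ t ∈ H, MeasurePreserving (translate t) μ μ) :
    ∀ᵐ G ∂μ, ∀ M, G.IsCut M 0 →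
      (∀ r : ℝ, ∃ u ≥ r, G.IsCut M u) ∧ ∀ r : ℝ, ∃ v ≤ r, G.IsCut M v := by
  obtain ⟨t, htH, ht⟩ : ∃ t ∈ H, 0 < t := by
    obtain ⟨t, htH, ht⟩ := H.bot_or_exists_ne_zero.resolve_left hH
    rcases ht.lt_or_gt with h | h
    · exact ⟨-t, H.neg_mem htH, neg_pos.2 h⟩
    · exact ⟨t, htH, h⟩
  rw [ae_all_iff]
  intro M
  -- Poincaré recurrence in both directions: a cut of the `n`-th iterate at `0` is a cut of `G` at
  -- `-n * t`, so `-t` yields the cuts on the right.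
  filter_upwards [(hinv t htH).conservative.ae_mem_imp_frequently_image_mem
      (measurableSet_isCut M 0).nullMeasurableSet,
    (hinv (-t) (H.neg_mem htH)).conservative.ae_mem_imp_frequently_image_mem
      (measurableSet_isCut M 0).nullMeasurableSet] with G h1 h2 h0
  have hlarge (r : ℝ) : ∀ᶠ n : ℕ in atTop, r ≤ n * t :=
    (tendsto_natCast_atTop_atTop.atTop_mul_const ht).eventually_ge_atTop r
  constructor
  · intro r
    obtain ⟨n, hn, hr⟩ := ((h2 h0).and_eventually (hlarge r)).exists
    exact ⟨_, by simpa using hr, (isCut_iterate_translate G (-t) M n 0).1 hn⟩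
  · intro r
    obtain ⟨n, hn, hr⟩ := ((h1 h0).and_eventually (hlarge (-r))).exists
    exact ⟨_, by linarith, (isCut_iterate_translate G t M n 0).1 hn⟩

/-- If long edges eventually disappear at the exponential scale, all degrees are finite. -/
theorem finite_neighborSet (G : GeomGraph) (hfin : ∀ r : ℝ, (G.verts ∩ Icc (-r) r).Finite)
    (hlong : ∀ᶠ k in atTop, ¬ G.HasLongEdge k) (y : G.verts) :
    (G.graph.neighborSet y).Finite := by
  have h2 : Tendsto (fun k : ℕ => (2 : ℝ) ^ k) atTop atTop :=
    tendsto_pow_atTop_atTop_of_one_lt one_lt_two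
  obtain ⟨k, hk, hyk⟩ := (hlong.and (h2.eventually_ge_atTop |(y : ℝ)|)).exists
  have hsub : Subtype.val '' (G.graph.neighborSet y) ⊆
      G.verts ∩ Icc (-((2 : ℝ) ^ k + 2 ^ k)) (2 ^ k + 2 ^ k) := by
    rintro _ ⟨z, hz, rfl⟩
    have hlt : |(y : ℝ) - z| < 2 ^ k := by
      by_contra! hge
      exact hk ⟨y, ⟨y.2, abs_le.1 hyk⟩, z, z.2, hge, hz⟩
    have h1 := abs_lt.1 hlt
    have h3 := abs_le.1 hyk
    exact ⟨z.2, by linarith, by linarith⟩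
  exact ((hfin _).subset hsub).of_finite_image Subtype.val_injective.injOn

/-- If long edges eventually disappear at the exponential scale, the origin is a cut. -/
theorem exists_isCut_zero (G : GeomGraph) (hfin : ∀ r : ℝ, (G.verts ∩ Icc (-r) r).Finite)
    (hlong : ∀ᶠ k in atTop, ¬ G.HasLongEdge k) : ∃ M, G.IsCut M 0 := by
  obtain ⟨k₀, hk₀⟩ := eventually_atTop.1 hlong
  have hpos : (1 : ℝ) ≤ 2 ^ k₀ := one_le_pow₀ one_le_two
  have key (a b : ℝ) (hab : G.Adj a b) (ha : a ≤ 0) (hb : 0 < b) : -2 ^ k₀ ≤ a ∧ b ≤ 2 ^ k₀ := by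
    have haV := G.edge_vert hab
    have hbV := G.edge_vert hab.symm
    have hlen : |a - b| = b - a := by rw [abs_sub_comm, abs_of_pos (by linarith)]
    have hlen' : |b - a| = b - a := abs_of_pos (by linarith)
    by_contra hcon
    -- At this scale the endpoint nearer to `0` lies in the window while the edge is long. If the
    -- nearer endpoint is beyond `2 ^ k₀`, the next power of two works, as the length is at least
    -- twice its distance to `0`.
    obtain ⟨k, hk, hmin, hmax⟩ : ∃ k ≥ k₀, (-a ≤ 2 ^ k ∨ b ≤ 2 ^ k) ∧ 2 ^ k ≤ b - a := by
      by_cases hs : min (-a) b ≤ 2 ^ k₀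
      · refine ⟨k₀, le_rfl, min_le_iff.1 hs, ?_⟩
        by_contra! h
        exact hcon ⟨by linarith, by linarith⟩
      · push Not at hs
        obtain ⟨n, hn1, hn2⟩ := exists_nat_pow_near (hpos.trans hs.le) (one_lt_two (α := ℝ))
        refine ⟨n + 1, ?_, min_le_iff.1 hn2.le, ?_⟩
        · exact ((pow_lt_pow_iff_right₀ (one_lt_two (α := ℝ))).1 (hs.trans hn2)).le
        · have h1 := hn1.trans (min_le_left _ _)
          have h2 := hn1.trans (min_le_right _ _)
          rw [pow_succ]
          linarith
    have hkpos : (0 : ℝ) < 2 ^ k := by positivity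
    refine hk₀ k hk ?_
    rcases hmin with h | h
    · exact ⟨a, ⟨haV, by linarith, by linarith⟩, b, hbV, by rwa [hlen], hab⟩
    · exact ⟨b, ⟨hbV, by linarith, by linarith⟩, a, haV, by rwa [hlen'], hab.symm⟩
  have hfinite : ({p : ℝ × ℝ | G.Adj p.1 p.2} ∩ Iic 0 ×ˢ Ioi 0).Finite := by
    refine ((hfin (2 ^ k₀)).prod (hfin (2 ^ k₀))).subset ?_
    rintro ⟨a, b⟩ ⟨hab, ha, hb⟩
    have ha : a ≤ 0 := ha
    have hb : 0 < b := hb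
    obtain ⟨h1, h2⟩ := key a b hab ha hb
    exact ⟨⟨G.edge_vert hab, h1, by linarith⟩,
      ⟨G.edge_vert (G.symm.symm _ _ hab), by linarith, h2⟩⟩
  refine ⟨max hfinite.toFinset.card (2 * 2 ^ k₀), ?_, ?_⟩
  · rw [hfinite.encard_eq_coe_toFinset_card]
    exact_mod_cast le_max_left _ _
  · rw [Set.encard_eq_zero, Set.eq_empty_iff_forall_notMem]
    rintro ⟨a, b⟩ ⟨hab, ⟨ha, hb⟩, hlt⟩
    obtain ⟨h1, h2⟩ := key a b hab ha hb
    have hle : ((2 * 2 ^ k₀ : ℕ) : ℝ) ≤ (max hfinite.toFinset.card (2 * 2 ^ k₀) : ℕ) :=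
      Nat.cast_le.2 (le_max_right _ _)
    simp only [mem_ofPred_eq] at hlt
    push_cast at hle hlt
    linarith

end GeomGraph

/-! ### Potentials, test functions and recurrence -/

namespace GeomGraph

/-- The conductance between `x` and `A` is at most the current out of `x` at a potential `h` which
vanishes at `x`, equals `1` on `A`, and is harmonic at all other
vertices. -/
theorem exists_potential (G : GeomGraph) (x : G.verts) (A : Set G.verts) (hxA : x ∉ A)
    (hfin : ∀ y, (G.graph.neighborSet y).Finite) :
    ∃ h : G.verts → ℝ, h x = 0 ∧ (∀ y ∈ A, h y = 1) ∧
      (∀ y, y ∉ A → y ≠ x → ∑ z ∈ (hfin y).toFinset, (h y - h z) = 0) ∧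
      G.effConductance x A ≤ ENNReal.ofReal (∑ z ∈ (hfin x).toFinset, h z) := by
  classical
  -- Knaster–Tarski provides a solution of the boundary value problem even when the cluster is
  -- infinite; minimality gives `u ≤ 1`.
  let T : (G.verts → ℝ≥0∞) →o (G.verts → ℝ≥0∞) :=
    { toFun := fun f y => if y ∈ A then 1 else if y = x then 0 else
        ∫⁻ z, f z ∂(G.step y).toMeasure
      monotone' := by
        intro f g hfg y
        dsimp only
        split_ifs
        · exact le_rfl
        · exact le_rfl
        · exact lintegral_mono hfg }
  let u : G.verts → ℝ≥0∞ := T.lfp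
  have hu (y : G.verts) : u y = if y ∈ A then 1 else if y = x then 0 else
      ∫⁻ z, u z ∂(G.step y).toMeasure := congrFun T.map_lfp.symm y
  have hu1 (y : G.verts) : u y ≤ 1 := by
    refine (T.lfp_le (a := fun _ => 1) fun y => ?_ : T.lfp ≤ fun _ => 1) y
    change (if y ∈ A then (1 : ℝ≥0∞) else if y = x then 0 else
      ∫⁻ z, 1 ∂(G.step y).toMeasure) ≤ 1
    split_ifs <;> simp
  have hutop (y : G.verts) : u y ≠ ∞ := ((hu1 y).trans_lt ENNReal.one_lt_top).ne
  have hmean (y : G.verts) : ((hfin y).toFinset.card : ℝ≥0∞) * ∫⁻ z, u z ∂(G.step y).toMeasure =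
      ENNReal.ofReal (∑ z ∈ (hfin y).toFinset, (u z).toReal) := by
    rw [ENNReal.ofReal_sum_of_nonneg fun _ _ => ENNReal.toReal_nonneg]
    simp only [ENNReal.ofReal_toReal (hutop _)]
    by_cases hne : (G.graph.neighborSet y).Nonempty
    · have hcard : ((hfin y).toFinset.card : ℝ≥0∞) ≠ 0 := by
        simpa [Finset.card_eq_zero] using hne.ne_empty
      have hstep : G.step y = PMF.uniformOfFinset (hfin y).toFinset
          ((hfin y).toFinset_nonempty.2 hne) := dif_pos ⟨hfin y, hne⟩
      rw [lintegral_countable', hstep, tsum_eq_sum (s := (hfin y).toFinset), Finset.mul_sum]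
      · refine Finset.sum_congr rfl fun z hz => ?_
        rw [PMF.toMeasure_apply_singleton _ _ (measurableSet_singleton z),
          PMF.uniformOfFinset_apply_of_mem _ hz, mul_comm (u z), ← mul_assoc,
          ENNReal.mul_inv_cancel hcard (ENNReal.natCast_ne_top _), one_mul]
      · intro z hz
        rw [PMF.toMeasure_apply_singleton _ _ (measurableSet_singleton z),
          PMF.uniformOfFinset_apply_of_notMem _ hz, mul_zero]
    · have : (hfin y).toFinset = ∅ := by
        simpa using Set.not_nonempty_iff_eq_empty.1 hne
      simp [this]
  refine ⟨fun y => (u y).toReal, ?_, ?_, ?_, ?_⟩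
  · simp [hu x, hxA]
  · intro y hy
    simp [hu y, hy]
  · intro y hyA hyx
    have h1 := hmean y
    have h2 := hu y
    rw [if_neg hyA, if_neg hyx] at h2
    rw [← h2] at h1
    have h3 := congrArg ENNReal.toReal h1
    rw [ENNReal.toReal_mul, ENNReal.toReal_natCast, ENNReal.toReal_ofReal
      (Finset.sum_nonneg fun _ _ => ENNReal.toReal_nonneg)] at h3
    rw [Finset.sum_sub_distrib, Finset.sum_const, nsmul_eq_mul, h3, sub_self]
  · rw [← hmean x, effConductance, (hfin x).encard_eq_coe_toFinset_card]
    refine mul_le_mul_right (G.walk_escape_le x A u (fun y hy => ?_) fun y hyA hyx => ?_) _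
    · rw [hu y, if_pos hy]
    · rw [hu y, if_neg hyA, if_neg hyx]

/-- A sequence of `M`-cuts on both sides of `x` whose distances are at least `M`. -/
theorem exists_cut_seq (G : GeomGraph) (M : ℕ) (hr : ∀ r : ℝ, ∃ u ≥ r, G.IsCut M u)
    (hl : ∀ r : ℝ, ∃ v ≤ r, G.IsCut M v) (x : ℝ) :
    ∃ u v : ℕ → ℝ, (∀ i, G.IsCut M (u i)) ∧ (∀ i, G.IsCut M (v i)) ∧
      (∀ i, v i < x ∧ x ≤ u i) ∧ (∀ i j, v i + M ≤ u j) ∧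
      (∀ i j, i < j → u i + M ≤ u j) ∧ ∀ i j, i < j → v j + M ≤ v i := by
  choose U hU hUc using hr
  choose L hL hLc using hl
  -- The offset `M` separates right cuts from left cuts; the offset `1` makes `v i < x` strict.
  let u : ℕ → ℝ := fun n => Nat.rec (U (x + M)) (fun _ r => U (r + M)) n
  let v : ℕ → ℝ := fun n => Nat.rec (L (x - 1)) (fun _ r => L (r - M)) n
  have hu0 : x + M ≤ u 0 := hU _
  have hv0 : v 0 ≤ x - 1 := hL _
  have hus (n : ℕ) : u n + M ≤ u (n + 1) := hU _
  have hvs (n : ℕ) : v (n + 1) ≤ v n - M := hL _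
  have hM : (0 : ℝ) ≤ M := M.cast_nonneg
  have humono : Monotone u := monotone_nat_of_le_succ fun n => by linarith [hus n]
  have hvanti : Antitone v := antitone_nat_of_succ_le fun n => by linarith [hvs n]
  refine ⟨u, v, ?_, ?_, ?_, ?_, ?_, ?_⟩
  · rintro (_ | n) <;> exact hUc _
  · rintro (_ | n) <;> exact hLc _
  · intro i
    have h1 := humono (Nat.zero_le i)
    have h2 := hvanti (Nat.zero_le i)
    constructor <;> linarith
  · intro i j
    have h1 := humono (Nat.zero_le j)
    have h2 := hvanti (Nat.zero_le i)
    linarith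
  · intro i j hij
    exact (hus i).trans (humono hij)
  · intro i j hij
    have h1 := hvanti (Nat.succ_le_of_lt hij)
    have h2 := hvs i
    simp only [Nat.succ_eq_add_one] at h1
    linarith

open Classical in
/-- The test function which grows by `1 / K` at each of the first `K` pairs of cuts has energy at
most `4 M / K`. -/
theorem exists_test_function (G : GeomGraph) (M : ℕ) (hr : ∀ r : ℝ, ∃ u ≥ r, G.IsCut M u)
    (hl : ∀ r : ℝ, ∃ v ≤ r, G.IsCut M v) (x : G.verts) (K : ℕ) (hK : 0 < K) :
    ∃ (g : G.verts → ℝ) (r : ℝ), g x = 0 ∧ (∀ y : G.verts, (y : ℝ) ∉ Icc (-r) r → g y = 1) ∧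
      ∀ W : Finset G.verts, ∑ a ∈ W, ∑ b ∈ W, (if G.graph.Adj a b then (g a - g b) ^ 2 else 0) ≤
        4 * M / K := by
  obtain ⟨u, v, hu, hv, hx, hvu, huu, hvv⟩ := G.exists_cut_seq M hr hl x
  let f : ℕ → G.verts → ℝ := fun i y => if v i < y ∧ (y : ℝ) ≤ u i then 0 else 1
  let g : G.verts → ℝ := fun y => (∑ i ∈ Finset.range K, f i y) / K
  have hK' : (0 : ℝ) < K := Nat.cast_pos.2 hK
  have hM : (0 : ℝ) ≤ M := M.cast_nonneg
  let R : (c : ℝ) → G.verts → G.verts → ℝ := fun c a b => if (a : ℝ) ≤ c ∧ c < b then 1 else 0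
  have hR0 (c : ℝ) (a b : G.verts) : 0 ≤ R c a b := by
    simp only [R]; split_ifs <;> norm_num
  have hcross (i : ℕ) (a b : G.verts) (h : f i a ≠ f i b) :
      ((a : ℝ) ≤ u i ∧ u i < b) ∨ ((b : ℝ) ≤ u i ∧ u i < a) ∨
        ((a : ℝ) ≤ v i ∧ v i < b) ∨ ((b : ℝ) ≤ v i ∧ v i < a) := by
    simp only [f] at h
    by_contra! hcon
    obtain ⟨h1, h2, h3, h4⟩ := hcon
    split_ifs at h with ha hb hb
    · exact h rfl
    · refine hb ⟨?_, h1 ha.2⟩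
      by_contra! hlt
      linarith [h4 hlt, ha.1]
    · refine ha ⟨?_, h2 hb.2⟩
      by_contra! hlt
      linarith [h3 hlt, hb.1]
    · exact h rfl
  have hfsq (i : ℕ) (a b : G.verts) : (f i a - f i b) ^ 2 ≤
      R (u i) a b + R (u i) b a + (R (v i) a b + R (v i) b a) := by
    by_cases h : f i a = f i b
    · rw [h, sub_self]
      have := hR0 (u i) a b
      have := hR0 (u i) b a
      have := hR0 (v i) a b
      have := hR0 (v i) b a
      norm_num
      linarith
    · have h1 : (f i a - f i b) ^ 2 ≤ 1 := by
        simp only [f]; split_ifs <;> norm_num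
      have := hR0 (u i) a b
      have := hR0 (u i) b a
      have := hR0 (v i) a b
      have := hR0 (v i) b a
      rcases hcross i a b h with h' | h' | h' | h'
      · have : R (u i) a b = 1 := if_pos h'
        linarith
      · have : R (u i) b a = 1 := if_pos h'
        linarith
      · have : R (v i) a b = 1 := if_pos h'
        linarith
      · have : R (v i) b a = 1 := if_pos h'
        linarith
  -- Crossing two cuts in the same direction forces length greater than `M`; opposite directions are
  -- incompatible with the order of the cuts.
  have hdisj (a b : G.verts) (hab : G.graph.Adj a b) (i j : ℕ) (hij : i < j)
      (hi : f i a ≠ f i b) (hj : f j a ≠ f j b) : False := by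
    have hab' : G.Adj a b := hab
    have hba' : G.Adj b a := G.symm.symm _ _ hab
    have e1 := huu i j hij
    have e2 := hvv i j hij
    have e3 := hvu i j
    have e4 := hvu j i
    rcases hcross i a b hi with h | h | h | h <;> rcases hcross j a b hj with h' | h' | h' | h'
    · linarith [(hu i).sub_le hab' h.1 h.2]
    · linarith
    · linarith [(hu i).sub_le hab' h.1 h.2]
    · linarith
    · linarith
    · linarith [(hu i).sub_le hba' h.1 h.2]
    · linarith
    · linarith [(hu i).sub_le hba' h.1 h.2]
    · linarith [(hv i).sub_le hab' h.1 h.2]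
    · linarith
    · linarith [(hv i).sub_le hab' h.1 h.2]
    · linarith
    · linarith
    · linarith [(hv i).sub_le hba' h.1 h.2]
    · linarith
    · linarith [(hv i).sub_le hba' h.1 h.2]
  -- At most one summand is nonzero, so the square of the sum is the sum of squares. This is the
  -- gain of a factor `K`.
  have hgsq (a b : G.verts) (hab : G.graph.Adj a b) :
      (g a - g b) ^ 2 = (∑ i ∈ Finset.range K, (f i a - f i b) ^ 2) / K ^ 2 := by
    have : (∑ i ∈ Finset.range K, (f i a - f i b)) ^ 2 =
        ∑ i ∈ Finset.range K, (f i a - f i b) ^ 2 := by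
      by_cases h : ∃ i ∈ Finset.range K, f i a ≠ f i b
      · obtain ⟨i, hiK, hi⟩ := h
        have hne (j : ℕ) (hji : j ≠ i) : f j a - f j b = 0 := by
          by_contra hj
          rcases hji.lt_or_gt with h | h
          · exact hdisj a b hab j i h (sub_ne_zero.1 hj) hi
          · exact hdisj a b hab i j h hi (sub_ne_zero.1 hj)
        rw [Finset.sum_eq_single_of_mem i hiK fun j _ hji => hne j hji,
          Finset.sum_eq_single_of_mem i hiK fun j _ hji => by rw [hne j hji]; norm_num]
      · push Not at h
        rw [Finset.sum_eq_zero fun i hi => by rw [h i hi, sub_self],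
          Finset.sum_eq_zero fun i hi => by rw [h i hi, sub_self]; norm_num]
        norm_num
    rw [← this, Finset.sum_sub_distrib]
    simp only [g]
    rw [← sub_div, div_pow]
  refine ⟨g, ∑ i ∈ Finset.range K, (|u i| + |v i|), ?_, ?_, ?_⟩
  · simp [g, f, hx]
  · intro y hy
    have h1 (i : ℕ) (hi : i ∈ Finset.range K) : f i y = 1 := by
      refine if_neg fun hy' => hy ?_
      have := Finset.single_le_sum (f := fun i => |u i| + |v i|)
        (fun i _ => by positivity) hi
      have h1 := le_abs_self (u i)
      have h2 := neg_abs_le (v i)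
      have h3 := abs_nonneg (u i)
      have h4 := abs_nonneg (v i)
      constructor <;> linarith [hy'.1, hy'.2]
    simp only [g]
    rw [Finset.sum_congr rfl h1]
    simp [hK'.ne']
  · intro W
    -- The factor `2` comes from summing over ordered pairs.
    have hcut (c : ℝ) (hc : G.IsCut M c) : ∑ a ∈ W, ∑ b ∈ W,
        (if G.graph.Adj a b then R c a b + R c b a else 0) ≤ 2 * M := by
      have e1 := hc.sum_le W
      have e2 := e1
      rw [Finset.sum_comm] at e2
      have : ∑ a ∈ W, ∑ b ∈ W, (if G.graph.Adj a b then R c a b + R c b a else 0) =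
          ∑ a ∈ W, ∑ b ∈ W, (if G.graph.Adj a b then R c a b else 0) +
          ∑ a ∈ W, ∑ b ∈ W, (if G.graph.Adj b a then R c b a else 0) := by
        simp only [← Finset.sum_add_distrib]
        refine Finset.sum_congr rfl fun a _ => Finset.sum_congr rfl fun b _ => ?_
        simp only [G.graph.adj_comm b a]
        split_ifs <;> simp
      rw [this, two_mul]
      exact add_le_add e1 e2
    have hle (a b : G.verts) : (if G.graph.Adj a b then (g a - g b) ^ 2 else 0) ≤
        (∑ i ∈ Finset.range K, ((if G.graph.Adj a b then R (u i) a b + R (u i) b a else 0) +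
          (if G.graph.Adj a b then R (v i) a b + R (v i) b a else 0))) / K ^ 2 := by
      split_ifs with hab
      · rw [hgsq a b hab]
        gcongr with i
        exact hfsq i a b
      · simp
    calc _ ≤ ∑ a ∈ W, ∑ b ∈ W, (∑ i ∈ Finset.range K,
          ((if G.graph.Adj a b then R (u i) a b + R (u i) b a else 0) +
          (if G.graph.Adj a b then R (v i) a b + R (v i) b a else 0))) / (K : ℝ) ^ 2 :=
          Finset.sum_le_sum fun a _ => Finset.sum_le_sum fun b _ => hle a b
      _ = (∑ i ∈ Finset.range K, (∑ a ∈ W, ∑ b ∈ W,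
          (if G.graph.Adj a b then R (u i) a b + R (u i) b a else 0) +
          ∑ a ∈ W, ∑ b ∈ W,
          (if G.graph.Adj a b then R (v i) a b + R (v i) b a else 0))) / (K : ℝ) ^ 2 := by
          simp only [← Finset.sum_div, ← Finset.sum_add_distrib]
          congr 1
          symm
          rw [Finset.sum_comm]
          exact Finset.sum_congr rfl fun a _ => Finset.sum_comm
      _ ≤ (∑ i ∈ Finset.range K, (2 * M + 2 * M : ℝ)) / (K : ℝ) ^ 2 := by
          gcongr with i
          · exact hcut _ (hu i)
          · exact hcut _ (hv i)
      _ = 4 * M / K := by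
          rw [Finset.sum_const, Finset.card_range, nsmul_eq_mul]
          field_simp
          ring

/-- A locally finite graph with finite degrees and `M`-cuts arbitrarily far out on both sides has
only recurrent clusters. -/
theorem clusterRecurrent_of_isCut (G : GeomGraph)
    (hfin : ∀ r : ℝ, (G.verts ∩ Icc (-r) r).Finite)
    (hdeg : ∀ y, (G.graph.neighborSet y).Finite) (M : ℕ)
    (hr : ∀ r : ℝ, ∃ u ≥ r, G.IsCut M u) (hl : ∀ r : ℝ, ∃ v ≤ r, G.IsCut M v) (x : G.verts) :
    G.ClusterRecurrent x := by
  classical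
  refine ⟨fun y _ => hdeg y, ENNReal.tendsto_nhds_zero.2 fun ε hε => ?_⟩
  have hlim : Tendsto (fun K : ℕ => ENNReal.ofReal (2 * M / K)) atTop (𝓝 0) := by
    simpa using ENNReal.tendsto_ofReal (tendsto_const_div_atTop_nhds_zero_nat (2 * M : ℝ))
  obtain ⟨K, hKε, hK⟩ :=
    (((ENNReal.tendsto_nhds_zero.1 hlim) ε hε).and (eventually_gt_atTop 0)).exists
  obtain ⟨g, r, hgx, hg1, hgE⟩ := G.exists_test_function M hr hl x K hK
  have hn : ∀ᶠ n : ℕ in atTop, max r |(x : ℝ)| ≤ n :=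
    tendsto_natCast_atTop_atTop.eventually_ge_atTop _
  filter_upwards [hn] with n hn
  refine le_trans ?_ hKε
  have hrn : r ≤ n := (le_max_left _ _).trans hn
  have hxn : (x : ℝ) ∈ Icc (-(n : ℝ)) n := abs_le.1 ((le_max_right _ _).trans hn)
  set A : Set G.verts := {y | G.graph.Reachable x y ∧ (y : ℝ) ∉ Icc (-(n : ℝ)) n} with hA
  obtain ⟨h, hhx, hhA, hharm, hcond⟩ := G.exists_potential x A (fun hx => hx.2 hxn) hdeg
  refine hcond.trans (ENNReal.ofReal_le_ofReal ?_)
  have hSfin : {y : G.verts | G.graph.Reachable x y ∧ (y : ℝ) ∈ Icc (-(n : ℝ)) n}.Finite := by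
    refine Set.Finite.of_finite_image ((hfin n).subset ?_) Subtype.val_injective.injOn
    rintro _ ⟨y, hy, rfl⟩
    exact ⟨y.2, hy.2⟩
  let S : Finset G.verts := hSfin.toFinset
  have hS (y : G.verts) : y ∈ S ↔ G.graph.Reachable x y ∧ (y : ℝ) ∈ Icc (-(n : ℝ)) n :=
    hSfin.mem_toFinset
  -- Adding all neighbours of `S` makes the sums over `W` see every edge at a vertex of `S`; the
  -- added vertices outside `S` lie in `A`.
  let W : Finset G.verts := S ∪ S.biUnion fun y => (hdeg y).toFinset
  have hxS : x ∈ S := (hS x).2 ⟨.rfl, hxn⟩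
  have hWA (y : G.verts) (hyW : y ∈ W) (hyS : y ∉ S) : y ∈ A := by
    rcases Finset.mem_union.1 hyW with h | h
    · exact absurd h hyS
    · obtain ⟨z, hz, hzy⟩ := Finset.mem_biUnion.1 h
      have hzy : G.graph.Adj z y := by simpa using hzy
      have hreach := ((hS z).1 hz).1.trans hzy.reachable
      exact ⟨hreach, fun hy => hyS ((hS y).2 ⟨hreach, hy⟩)⟩
  have hnbr (y : G.verts) (hy : y ∈ S) : {z ∈ W | G.graph.Adj y z} = (hdeg y).toFinset := by
    ext z
    simp only [Finset.mem_filter, Set.Finite.mem_toFinset, SimpleGraph.mem_neighborSet]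
    refine ⟨fun hz => hz.2, fun hz => ⟨Finset.mem_union_right _ ?_, hz⟩⟩
    exact Finset.mem_biUnion.2 ⟨y, hy, by simpa using hz⟩
  have hdir := G.graph.current_le_energy W S x (Finset.mem_union_left _ hxS) h g hhx hgx
    (fun a haW haS => hhA a (hWA a haW haS))
    (fun a haW haS => hg1 a fun ha => (hWA a haW haS).2 ⟨by linarith [ha.1], ha.2.trans hrn⟩)
    (fun a ha hax => by
      rw [← Finset.sum_filter, hnbr a ha]
      exact hharm a (fun haA => haA.2 ((hS a).1 ha).2) hax)
  rw [← Finset.sum_filter, hnbr x hxS] at hdir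
  have := hdir.trans (hgE W)
  have e : (4 * M / K : ℝ) = 2 * (2 * M / K) := by ring
  rw [e] at this
  linarith

end GeomGraph

theorem mainTheorem3 {Ω : Type*} [MeasurableSpace Ω] (P : Measure Ω) [IsProbabilityMeasure P]
    (G : Ω → GeomGraph) (hG : Measurable G)
    (hfin : ∀ᵐ ω ∂P, ∀ r : ℝ, ((G ω).verts ∩ Icc (-r) r).Finite)
    (H : AddSubgroup ℝ) (hH : H ≠ ⊥)
    (herg : GeomGraph.InvariantErgodic H (P.map G))
    (hlong : (∑' k : ℕ, P {ω | (G ω).HasLongEdge k}) ≠ ∞) :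
    ∀ᵐ ω ∂P, ∀ x : (G ω).verts, (G ω).ClusterRecurrent x := by
  have hfinite : IsFiniteMeasure (P.map G) := by
    have := Measure.isProbabilityMeasure_map (μ := P) hG.aemeasurable
    infer_instance
  filter_upwards [hfin, ae_eventually_notMem hlong,
    ae_of_ae_map hG.aemeasurable (GeomGraph.ae_exists_isCut hH herg.invariant)] with ω h1 h2 h3 x
  obtain ⟨M, hM⟩ := (G ω).exists_isCut_zero h1 h2
  obtain ⟨hr, hl⟩ := h3 M hM
  exact (G ω).clusterRecurrent_of_isCut h1 ((G ω).finite_neighborSet h1 h2) M hr hl x
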